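/- **Corollary 3.1.** Let $(E,\rho)$ be a separable metric space with its Borel $\sigma$-algebra, let $\mu$ be a Borel probability measure on $E$, let $x_0\in E$, $p\ge 1$, $\alpha>1$, and put $\beta=\frac{\alpha}{\alpha-1}$. For Borel probability measures $\mu,\nu$ on $E$ define, with values in $[0,\infty]$, $$W_p(\mu,\nu)=\Big(\inf_\pi\iint\rho(x,y)^p\,d\pi(x,y)\Big)^{1/p},\qquad M_q=\Big(\int\rho(x,x_0)^q\,d\mu(x)\Big)^{1/q}\quad(q>0),$$ where the infimum is over all Borel probability measures $\pi$ on $E\times E$ with marginals $\mu$ and $\nu$, and $$T_\alpha=T_\alpha(\nu\|\mu)=\frac1{\alpha-1}\Big[\int f^\alpha\,d\mu-1\Big]\quad\text{if }\nu\ll\mu,\ f=\frac{d\nu}{d\mu},$$ and $T_\alpha=\infty$ if $\nu$ is not absolutely continuous with respect to $\mu$. There is an absolute constant $C<\infty$ (independent of $E,\rho,\mu,\nu,x_0,p,\alpha$) such that the following holds for every Borel probability measure $\nu$ on $E$. If $1<\alpha\le2$, then $$W_p(\mu,\nu)\le C\,M_{\beta p}\,\max\Big\{T_\alpha^{\frac1{2p}},\,T_\alpha^{\frac1{\alpha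 p}}\Big\}.$$ If $\alpha\ge2$, then $$W_p(\mu,\nu)\le 2\cdot3^{\alpha/p}\,M_{\beta p}\,T_\alpha^{\frac1{\alpha p}}.$$ Here the right-hand sides are read as $+\infty$ when $T_\alpha=\infty$, and as $0$ when $T_\alpha=0$ (also if $M_{\beta p}=\infty$). -/

import Mathlib

open MeasureTheory
open scoped ENNReal NNReal

namespace TransportEntropy

/-- The Kantorovich transport distance of order `p`,
`W_p(μ, ν) = (inf_π ∫∫ ρ(x, y)^p dπ(x, y))^(1/p)`, with values in `[0, ∞]`. The infimum runs over
all probability measures `π` on `E × E` with marginals `μ` and `ν`. (On a separable metric space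
the product of the Borel σ-algebras is the Borel σ-algebra of the product.) -/
noncomputable def kantorovichDist {E : Type*} [MetricSpace E] [MeasurableSpace E]
    (p : ℝ) (μ ν : Measure E) : ℝ≥0∞ :=
  (⨅ π ∈ {π : Measure (E × E) | IsProbabilityMeasure π ∧
      π.map Prod.fst = μ ∧ π.map Prod.snd = ν},
    ∫⁻ z, edist z.1 z.2 ^ p ∂π) ^ (1 / p)

/-- The moment `M_q = (∫ ρ(x, x₀)^q dμ(x))^(1/q)`, with values in `[0, ∞]`. -/
noncomputable def moment {E : Type*} [MetricSpace E] [MeasurableSpace E]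
    (q : ℝ) (μ : Measure E) (x₀ : E) : ℝ≥0∞ :=
  (∫⁻ x, edist x x₀ ^ q ∂μ) ^ (1 / q)

open Classical in
/-- The Rényi divergence power (Tsallis distance) of order `α > 1`,
`T_α(ν ‖ μ) = (∫ f^α dμ - 1) / (α - 1)` if `ν ≪ μ` with density `f = dν/dμ`, and `∞` otherwise.
For probability measures `∫ f^α dμ ≥ (∫ f dμ)^α = 1` (Jensen), so the subtraction in `[0, ∞]`
is never truncated. -/
noncomputable def tsallis {E : Type*} [MeasurableSpace E]
    (α : ℝ) (ν μ : Measure E) : ℝ≥0∞ :=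
  if ν ≪ μ then (∫⁻ x, ν.rnDeriv μ x ^ α ∂μ - 1) / ENNReal.ofReal (α - 1) else ∞

end TransportEntropy

/-! Let `f = dν/dμ`. Leave the common mass `min 1 f • μ` where it is and send the surplus `(1 - f)⁺
μ` to the deficit `(f - 1)⁺ μ` by a normalised product measure. Since `ρ(x, y)^p ≤ 2^(p-1) (ρ(x,
x₀)^p + ρ(y, x₀)^p)`, this plan costs at most `2^(p-1) ∫ ρ(x, x₀)^p |f - 1| dμ`, and Hölder with
exponents `β, α` gives `W_p ≤ 2 M_{βp} (∫ |f - 1|^α dμ)^(1/(αp))`.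

It remains to bound `∫ |f - 1|^α dμ` by `T_α`. As `∫ f dμ = 1`, `(α - 1) T_α` is the integral of the
Bernoulli gap `f^α - 1 - α (f - 1)`. For `α ≥ 2` the gap dominates `|f - 1|^α`. For `α ≤ 2` it
dominates only `(α - 1)/4 · min(|f - 1|^2, |f - 1|^α)`: the factor `α - 1` cancels the normalisation
of `T_α`, which makes `C` absolute, and the quadratic regime, through Jensen, produces the power
`T_α^(1/(2p))`. -/

namespace TransportEntropy

/-! ### Scalar lower bounds for the Bernoulli gap -/

/-- For exponents `α ≥ 2`, the gap in Bernoulli's inequality dominates `|r - 1| ^ α`. -/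
theorem abs_sub_one_rpow_le_bernoulli_gap {α r : ℝ} (hα : 2 ≤ α) (hr : 0 ≤ r) :
    |r - 1| ^ α + 1 + α * r ≤ r ^ α + α := by
  have hsplit : ∀ x : ℝ, 0 ≤ x → x ^ α = x * x ^ (α - 1) := fun x hx => by
    rw [← Real.rpow_one_add' hx (by linarith)]; congr 1; ring
  have hbern := one_add_mul_self_le_rpow_one_add (s := r - 1) (by linarith)
    (p := α - 1) (by linarith)
  rw [add_sub_cancel] at hbern
  rw [hsplit r hr]
  rcases le_total 1 r with h | h
  · rw [abs_of_nonneg (by linarith), hsplit _ (by linarith)]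
    -- Write `r^α = (r - 1) r^(α-1) + r^(α-1)`: superadditivity of the power `α - 1 ≥ 1` handles the
    -- first term, Bernoulli the second.
    have hsuper := Real.add_rpow_le_rpow_add (a := 1) (b := r - 1) zero_le_one (by linarith)
      (p := α - 1) (by linarith)
    rw [Real.one_rpow, add_sub_cancel] at hsuper
    nlinarith [mul_le_mul_of_nonneg_left hsuper (sub_nonneg.2 h)]
  · have hpow : |r - 1| ^ α ≤ |r - 1| ^ (2 : ℝ) :=
      Real.rpow_le_rpow_of_exponent_ge' (abs_nonneg _) (by rw [abs_le]; constructor <;> linarith)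
        zero_le_two hα
    rw [Real.rpow_two, sq_abs] at hpow
    nlinarith [mul_le_mul_of_nonneg_left hbern hr, mul_nonneg (sub_nonneg.2 hα) (sq_nonneg (r - 1))]

/-- Second-order Bernoulli inequality on `[0, 1]` for exponents in `(1, 2]`. -/
theorem sq_sub_one_le_bernoulli_gap {α r : ℝ} (h1 : 1 < α) (h2 : α ≤ 2) (hr : 0 ≤ r)
    (hr1 : r ≤ 1) : (α - 1) / 2 * (r - 1) ^ 2 + 1 + α * r ≤ r ^ α + α := by
  have hanti : AntitoneOn (fun x : ℝ => x ^ α + α - ((α - 1) / 2 * (x - 1) ^ 2 + 1 + α * x))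
      (Set.Icc 0 1) := by
    have hd : ∀ x : ℝ, HasDerivAt
        (fun x : ℝ => x ^ α + α - ((α - 1) / 2 * (x - 1) ^ 2 + 1 + α * x))
        (α * x ^ (α - 1) - ((α - 1) * (x - 1) + α)) x := fun x => by
      have e1 := (Real.hasDerivAt_rpow_const (x := x) (p := α) (Or.inr h1.le)).add_const α
      have e2 := (((((hasDerivAt_id x).sub_const 1).pow 2).const_mul ((α - 1) / 2)).add_const
        (1 : ℝ)).add ((hasDerivAt_id x).const_mul α)
      refine (e1.sub e2).congr_deriv ?_
      simp
      ring
    refine antitoneOn_of_deriv_nonpos (convex_Icc 0 1)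
      (fun x _ => (hd x).continuousAt.continuousWithinAt)
      (fun x _ => (hd x).differentiableAt.differentiableWithinAt) fun x hx => ?_
    rw [interior_Icc] at hx
    rw [(hd x).deriv]
    have hb := rpow_one_add_le_one_add_mul_self (s := x - 1) (by linarith [hx.1])
      (p := α - 1) (by linarith) (by linarith)
    rw [add_sub_cancel] at hb
    nlinarith [mul_le_mul_of_nonneg_left hb (zero_le_one.trans h1.le),
      mul_nonneg (sq_nonneg (α - 1)) (sub_nonneg.2 hx.2.le)]
  have := hanti ⟨hr, hr1⟩ ⟨zero_le_one, le_rfl⟩ hr1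
  simp only [Real.one_rpow] at this
  linarith

/-- The right side is the Bernoulli gap at `r = 1/s ≥ 1` multiplied by `s^α`; the inversion brings
the half-line `r ≥ 1` back to `(0, 1]`, where the difference of the two sides is monotone because
`x^(α-2) ≥ 1`. -/
theorem sq_one_sub_le_reciprocal_bernoulli_gap {α s : ℝ} (h1 : 1 < α) (h2 : α ≤ 2) (hs : 0 < s)
    (hs1 : s ≤ 1) :
    (α - 1) / 2 * (1 - s) ^ 2 ≤ 1 + (α - 1) * s ^ α - α * s ^ (α - 1) := by
  have hanti : AntitoneOn
      (fun x : ℝ => 1 + (α - 1) * x ^ α - α * x ^ (α - 1) - (α - 1) / 2 * (1 - x) ^ 2)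
      (Set.Ioc 0 1) := by
    have hd : ∀ x ∈ Set.Ioc (0 : ℝ) 1, HasDerivAt
        (fun x : ℝ => 1 + (α - 1) * x ^ α - α * x ^ (α - 1) - (α - 1) / 2 * (1 - x) ^ 2)
        ((α - 1) * ((x - 1) * (α * x ^ (α - 2) - 1))) x := fun x hx => by
      have e1 := ((Real.hasDerivAt_rpow_const (x := x) (p := α) (Or.inr h1.le)).const_mul
        (α - 1)).const_add 1
      have e2 := (Real.hasDerivAt_rpow_const (x := x) (p := α - 1) (Or.inl hx.1.ne')).const_mul α
      have e3 := (((hasDerivAt_id x).const_sub 1).pow 2).const_mul ((α - 1) / 2)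
      refine ((e1.sub e2).sub e3).congr_deriv ?_
      have e4 : x ^ (α - 1) = x * x ^ (α - 2) := by
        rw [← Real.rpow_one_add' hx.1.le (by linarith)]; congr 1; ring
      rw [e4, show α - 1 - 1 = α - 2 by ring]
      simp
      ring
    refine antitoneOn_of_deriv_nonpos (convex_Ioc 0 1)
      (fun x hx => (hd x hx).continuousAt.continuousWithinAt)
      (fun x hx => (hd x (interior_subset hx)).differentiableAt.differentiableWithinAt)
      fun x hx => ?_
    rw [(hd x (interior_subset hx)).deriv]
    obtain ⟨hx0, hx1⟩ := interior_subset hx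
    have : 1 ≤ x ^ (α - 2) := Real.one_le_rpow_of_pos_of_le_one_of_nonpos hx0 hx1 (by linarith)
    refine mul_nonpos_of_nonneg_of_nonpos (by linarith) ?_
    exact mul_nonpos_of_nonpos_of_nonneg (by linarith) (by nlinarith)
  have := hanti ⟨hs, hs1⟩ ⟨zero_lt_one, le_rfl⟩ hs1
  simp only [Real.one_rpow] at this
  linarith

/-- For exponents `1 < α ≤ 2`, the gap in Bernoulli's inequality is at least quadratic near `1`
and at least of order `α` away from `1`, uniformly after division by `α - 1`. -/
theorem min_sq_rpow_le_bernoulli_gap {α r : ℝ} (h1 : 1 < α) (h2 : α ≤ 2) (hr : 0 ≤ r) :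
    (α - 1) / 4 * min (|r - 1| ^ (2 : ℝ)) (|r - 1| ^ α) + 1 + α * r ≤ r ^ α + α := by
  have he : 0 < α - 1 := by linarith
  rcases le_or_gt r 1 with h | h
  · have hm : min (|r - 1| ^ (2 : ℝ)) (|r - 1| ^ α) ≤ (r - 1) ^ 2 := by
      refine (min_le_left _ _).trans_eq ?_
      rw [Real.rpow_two, sq_abs]
    nlinarith [sq_sub_one_le_bernoulli_gap h1 h2 hr h,
      mul_le_mul_of_nonneg_left hm he.le, mul_nonneg he.le (sq_nonneg (r - 1))]
  · have hr0 : 0 < r := by linarith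
    have hu : 0 < r - 1 := by linarith
    have key : (α - 1) / 2 * ((r - 1) ^ 2 * r ^ (α - 2)) + 1 + α * r ≤ r ^ α + α := by
      have hs := mul_le_mul_of_nonneg_right (sq_one_sub_le_reciprocal_bernoulli_gap h1 h2
        (inv_pos.2 hr0) (inv_le_one_of_one_le₀ h.le)) (Real.rpow_nonneg hr α)
      rw [Real.inv_rpow hr, Real.inv_rpow hr, Real.rpow_sub_one hr0.ne'] at hs
      rw [Real.rpow_sub hr0, Real.rpow_two]
      have hp := (Real.rpow_pos_of_pos hr0 α).ne'
      have e1 : (1 + (α - 1) * (r ^ α)⁻¹ - α * (r ^ α / r)⁻¹) * r ^ α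
          = r ^ α + (α - 1) - α * r := by field_simp
      have e2 : (α - 1) / 2 * (1 - r⁻¹) ^ 2 * r ^ α
          = (α - 1) / 2 * ((r - 1) ^ 2 * (r ^ α / r ^ 2)) := by field_simp
      rw [e1, e2] at hs
      linarith
    -- Replacing `r` by a comparable `v` costs at most a factor `2`, since `2^(α-2) ≥ 1/2`. It is
    -- used with `v = 1` for `r ≤ 2` and `v = r - 1` for `r ≥ 2`, and turns `(α - 1)/2` into `(α -
    -- 1)/4`.
    have half : ∀ v : ℝ, 0 < v → r ≤ 2 * v → v ^ (α - 2) / 2 ≤ r ^ (α - 2) := fun v hv hrv => by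
      have ha := Real.rpow_le_rpow_of_nonpos hr0 hrv (show α - 2 ≤ 0 by linarith)
      have hb := Real.rpow_le_rpow_of_exponent_le one_le_two (show (-1 : ℝ) ≤ α - 2 by linarith)
      rw [Real.mul_rpow zero_le_two hv.le] at ha
      rw [Real.rpow_neg_one] at hb
      nlinarith [Real.rpow_pos_of_pos hv (α - 2)]
    have hm : min (|r - 1| ^ (2 : ℝ)) (|r - 1| ^ α) ≤ 2 * ((r - 1) ^ 2 * r ^ (α - 2)) := by
      rw [abs_of_pos hu]
      rcases le_total (r - 1) 1 with h' | h'
      · refine (min_le_left _ _).trans ?_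
        have := half 1 one_pos (by linarith)
        rw [Real.one_rpow] at this
        rw [Real.rpow_two]
        nlinarith [mul_le_mul_of_nonneg_left this (sq_nonneg (r - 1))]
      · refine (min_le_right _ _).trans ?_
        have := mul_le_mul_of_nonneg_left (half (r - 1) hu (by linarith)) (sq_nonneg (r - 1))
        have e : (r - 1) ^ α = (r - 1) ^ 2 * (r - 1) ^ (α - 2) := by
          rw [← Real.rpow_two, ← Real.rpow_add hu]; congr 1; ring
        rw [e]
        linarith
    nlinarith [mul_le_mul_of_nonneg_left hm he.le]

/-! ### The coupling and its cost -/

variable {E : Type*} [MeasurableSpace E]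

/-- Surplus and deficit balance: adding `min 1 f`, whose integral is finite, turns both sides into
`1`. -/
theorem lintegral_one_sub_eq_lintegral_sub_one {μ : Measure E} [IsProbabilityMeasure μ]
    {f : E → ℝ≥0∞} (hf : Measurable f) (hf1 : ∫⁻ x, f x ∂μ = 1) :
    ∫⁻ x, (1 - f x) ∂μ = ∫⁻ x, (f x - 1) ∂μ := by
  have hm : ∫⁻ x, min 1 (f x) ∂μ ≠ ∞ := by
    refine ((lintegral_mono fun x => min_le_right _ _).trans_lt ?_).ne
    rw [hf1]
    exact ENNReal.one_lt_top
  rw [← ENNReal.add_left_inj hm,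
    ← lintegral_add_right _ (measurable_const.min hf),
    ← lintegral_add_right _ (measurable_const.min hf)]
  have e1 : ∀ x, 1 - f x + min 1 (f x) = 1 := fun x => tsub_add_min
  have e2 : ∀ x, f x - 1 + min 1 (f x) = f x := fun x => by rw [min_comm]; exact tsub_add_min
  simp [e1, e2, hf1]

/-- The coupling of `μ` and `f • μ` that leaves the common part `min 1 f • μ` in place and
transports the remaining mass independently. -/
noncomputable def diagonalProductCoupling (μ : Measure E) (f : E → ℝ≥0∞) : Measure (E × E) :=
  (μ.withDensity fun x => min 1 (f x)).map (fun x => (x, x)) +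
    (∫⁻ x, (f x - 1) ∂μ)⁻¹ •
      (μ.withDensity fun x => 1 - f x).prod (μ.withDensity fun x => f x - 1)

/-- Covers the degenerate case `c = 0` (that is, `f = 1` almost everywhere), where `c⁻¹ = ∞`
multiplies a zero measure. -/
theorem inv_smul_smul_withDensity {μ : Measure E} {g : E → ℝ≥0∞} {c : ℝ≥0∞}
    (hc : c ≠ ∞) (hgc : ∫⁻ x, g x ∂μ = c) :
    c⁻¹ • c • μ.withDensity g = μ.withDensity g := by
  rcases eq_or_ne c 0 with rfl | h0
  · have : μ.withDensity g = 0 := by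
      rw [← Measure.measure_univ_eq_zero, withDensity_apply _ MeasurableSet.univ,
        Measure.restrict_univ, hgc]
    simp [this]
  · rw [smul_smul, ENNReal.inv_mul_cancel h0 hc, one_smul]

theorem lintegral_sub_one_ne_top {μ : Measure E} {f : E → ℝ≥0∞}
    (hf1 : ∫⁻ x, f x ∂μ = 1) : ∫⁻ x, (f x - 1) ∂μ ≠ ∞ := by
  refine ((lintegral_mono fun x => tsub_le_self).trans_lt ?_).ne
  rw [hf1]
  exact ENNReal.one_lt_top

section Coupling

variable {μ : Measure E} [IsProbabilityMeasure μ] {f : E → ℝ≥0∞}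

theorem map_fst_diagonalProductCoupling (hf : Measurable f) (hf1 : ∫⁻ x, f x ∂μ = 1) :
    (diagonalProductCoupling μ f).map Prod.fst = μ := by
  rw [diagonalProductCoupling, Measure.map_add _ _ measurable_fst, Measure.map_smul,
    Measure.map_fst_prod, withDensity_apply _ MeasurableSet.univ, Measure.restrict_univ,
    Measure.map_map measurable_fst (by fun_prop),
    inv_smul_smul_withDensity (lintegral_sub_one_ne_top hf1)
      (lintegral_one_sub_eq_lintegral_sub_one hf hf1)]
  have hid : (Prod.fst ∘ fun x : E => (x, x)) = id := rfl
  rw [hid, Measure.map_id, ← withDensity_add_left (measurable_const.min hf)]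
  convert withDensity_one using 2
  ext x
  simp only [Pi.add_apply, Pi.one_apply]
  rw [add_comm]
  exact tsub_add_min

theorem map_snd_diagonalProductCoupling (hf : Measurable f) (hf1 : ∫⁻ x, f x ∂μ = 1) :
    (diagonalProductCoupling μ f).map Prod.snd = μ.withDensity f := by
  rw [diagonalProductCoupling, Measure.map_add _ _ measurable_snd, Measure.map_smul,
    Measure.map_snd_prod, withDensity_apply _ MeasurableSet.univ, Measure.restrict_univ,
    Measure.map_map measurable_snd (by fun_prop),
    lintegral_one_sub_eq_lintegral_sub_one hf hf1,
    inv_smul_smul_withDensity (lintegral_sub_one_ne_top hf1) rfl]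
  have hid : (Prod.snd ∘ fun x : E => (x, x)) = id := rfl
  rw [hid, Measure.map_id, ← withDensity_add_left (measurable_const.min hf)]
  congr 1
  ext x
  rw [Pi.add_apply, add_comm, min_comm]
  exact tsub_add_min

theorem isProbabilityMeasure_diagonalProductCoupling (hf : Measurable f)
    (hf1 : ∫⁻ x, f x ∂μ = 1) : IsProbabilityMeasure (diagonalProductCoupling μ f) := by
  refine ⟨?_⟩
  have h := congrArg (fun m => m Set.univ) (map_fst_diagonalProductCoupling hf hf1)
  simpa [Measure.map_apply measurable_fst MeasurableSet.univ] using h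

/-- A cost that vanishes on the diagonal and is dominated by a sum of two equal marginal costs
has total cost at most `∫ h |f - 1| dμ`. -/
theorem lintegral_diagonalProductCoupling_le (hf : Measurable f) (hf1 : ∫⁻ x, f x ∂μ = 1)
    {c : E × E → ℝ≥0∞} (hc : Measurable c) (hdiag : ∀ x, c (x, x) = 0)
    {h : E → ℝ≥0∞} (hh : Measurable h) (hle : ∀ x y, c (x, y) ≤ h x + h y) :
    ∫⁻ z, c z ∂(diagonalProductCoupling μ f) ≤ ∫⁻ x, h x * ((1 - f x) + (f x - 1)) ∂μ := by
  have hA : Measurable fun x => 1 - f x := measurable_const.sub hf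
  have hB : Measurable fun x => f x - 1 := hf.sub measurable_const
  rw [diagonalProductCoupling, lintegral_add_measure, lintegral_map hc (by fun_prop),
    lintegral_smul_measure]
  simp only [hdiag, lintegral_zero, zero_add, mul_add]
  have hAB := lintegral_one_sub_eq_lintegral_sub_one hf hf1
  set δ := ∫⁻ x, (f x - 1) ∂μ
  set A := μ.withDensity fun x => 1 - f x with hAdef
  set B := μ.withDensity fun x => f x - 1 with hBdef
  have hAu : A Set.univ = δ := by
    rw [hAdef, withDensity_apply _ MeasurableSet.univ, Measure.restrict_univ, hAB]
  have hBu : B Set.univ = δ := by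
    rw [hBdef, withDensity_apply _ MeasurableSet.univ, Measure.restrict_univ]
  have h1 : ∫⁻ z, h z.1 ∂(A.prod B) = δ * ∫⁻ x, h x ∂A := by
    rw [← lintegral_map (f := h) hh measurable_fst, Measure.map_fst_prod, lintegral_smul_measure,
      hBu, smul_eq_mul]
  have h2 : ∫⁻ z, h z.2 ∂(A.prod B) = δ * ∫⁻ x, h x ∂B := by
    rw [← lintegral_map (f := h) hh measurable_snd, Measure.map_snd_prod, lintegral_smul_measure,
      hAu, smul_eq_mul]
  calc δ⁻¹ • ∫⁻ z, c z ∂(A.prod B)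
      ≤ δ⁻¹ • ∫⁻ z, (h z.1 + h z.2) ∂(A.prod B) := by
        rw [smul_eq_mul, smul_eq_mul]
        gcongr with z
        exact hle z.1 z.2
    _ = (δ * δ⁻¹) * (∫⁻ x, h x ∂A + ∫⁻ x, h x ∂B) := by
        rw [lintegral_add_left (by fun_prop), h1, h2, smul_eq_mul]
        ring
    -- Only an inequality, because `δ * δ⁻¹ = 0` when `δ = 0`.
    _ ≤ ∫⁻ x, h x ∂A + ∫⁻ x, h x ∂B := mul_le_of_le_one_left' (ENNReal.mul_inv_le_one δ)
    _ = _ := by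
        rw [lintegral_withDensity_eq_lintegral_mul _ hA hh,
          lintegral_withDensity_eq_lintegral_mul _ hB hh, ← lintegral_add_left (hA.mul hh)]
        simp only [Pi.mul_apply, mul_comm]

end Coupling

/-- Transport distance bound by the moment and the `L^α`-distance of the density from `1`. -/
theorem kantorovichDist_withDensity_le {E : Type*} [MetricSpace E]
    [TopologicalSpace.SeparableSpace E] [MeasurableSpace E] [BorelSpace E]
    {μ : Measure E} [IsProbabilityMeasure μ] {f : E → ℝ≥0∞} (hf : Measurable f)
    (hf1 : ∫⁻ x, f x ∂μ = 1) (x₀ : E) {p α β : ℝ} (hp : 1 ≤ p) (hα : 1 < α)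
    (hβ : β = α / (α - 1)) :
    kantorovichDist p μ (μ.withDensity f) ≤ 2 * moment (β * p) μ x₀ *
      (∫⁻ x, ((1 - f x) + (f x - 1)) ^ α ∂μ) ^ (1 / (α * p)) := by
  have : SecondCountableTopology E := UniformSpace.secondCountable_of_separable E
  have hp0 : 0 < p := by linarith
  have hconj : β.HolderConjugate α := by
    rw [hβ]; exact (Real.HolderConjugate.conjExponent hα).symm
  have hβ0 : 0 < β := hconj.pos
  have hdist : Measurable fun x => edist x x₀ := by fun_prop
  have hcost : ∫⁻ z, edist z.1 z.2 ^ p ∂(diagonalProductCoupling μ f) ≤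
      2 ^ (p - 1) * ((∫⁻ x, edist x x₀ ^ (β * p) ∂μ) ^ (1 / β) *
        (∫⁻ x, ((1 - f x) + (f x - 1)) ^ α ∂μ) ^ (1 / α)) := by
    refine (lintegral_diagonalProductCoupling_le hf hf1 (c := fun z => edist z.1 z.2 ^ p)
      (h := fun x => 2 ^ (p - 1) * edist x x₀ ^ p) (by fun_prop) ?_ (by fun_prop) ?_).trans ?_
    · intro x
      simp [hp0]
    · intro x y
      rw [← mul_add]
      refine le_trans ?_ (ENNReal.rpow_add_le_mul_rpow_add_rpow _ _ hp)
      gcongr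
      exact edist_triangle_right x y x₀
    · simp only [mul_assoc]
      rw [lintegral_const_mul _ (by fun_prop)]
      gcongr
      have hH := ENNReal.lintegral_mul_le_Lp_mul_Lq μ hconj
        (f := fun x => edist x x₀ ^ p) (g := fun x => (1 - f x) + (f x - 1))
        (by fun_prop) (by fun_prop)
      simpa only [Pi.mul_apply, ← ENNReal.rpow_mul, mul_comm p β] using hH
  refine (ENNReal.rpow_le_rpow ((iInf₂_le (diagonalProductCoupling μ f)
    ⟨isProbabilityMeasure_diagonalProductCoupling hf hf1, map_fst_diagonalProductCoupling hf hf1,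
      map_snd_diagonalProductCoupling hf hf1⟩).trans hcost) (by positivity)).trans ?_
  rw [ENNReal.mul_rpow_of_nonneg _ _ (by positivity), ENNReal.mul_rpow_of_nonneg _ _ (by positivity),
    ← ENNReal.rpow_mul, ← ENNReal.rpow_mul, ← ENNReal.rpow_mul, moment,
    one_div_mul_one_div β p, one_div_mul_one_div α p, ← mul_assoc]
  gcongr
  calc (2 : ℝ≥0∞) ^ ((p - 1) * (1 / p)) ≤ 2 ^ (1 : ℝ) := by
        refine ENNReal.rpow_le_rpow_of_exponent_le one_le_two ?_
        rw [mul_one_div, div_le_one hp0]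
        linarith
    _ = 2 := ENNReal.rpow_one 2

/-! ### From the Bernoulli gap to the Tsallis distance -/

theorem one_sub_add_sub_one_ofReal {r : ℝ} (hr : 0 ≤ r) :
    (1 - ENNReal.ofReal r) + (ENNReal.ofReal r - 1) = ENNReal.ofReal |r - 1| := by
  rw [← ENNReal.ofReal_one, ← ENNReal.ofReal_sub _ hr, ← ENNReal.ofReal_sub _ zero_le_one]
  rcases le_total r 1 with h | h
  · rw [ENNReal.ofReal_of_nonpos (p := r - 1) (by linarith), add_zero, abs_sub_comm,
      abs_of_nonneg (sub_nonneg.2 h)]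
  · rw [ENNReal.ofReal_of_nonpos (p := 1 - r) (by linarith), zero_add,
      abs_of_nonneg (sub_nonneg.2 h)]

theorem ennreal_abs_sub_one_rpow_le_bernoulli_gap {α : ℝ} (hα : 2 ≤ α) {t : ℝ≥0∞} (ht : t ≠ ∞) :
    ((1 - t) + (t - 1)) ^ α + (1 + ENNReal.ofReal α * t) ≤ t ^ α + ENNReal.ofReal α := by
  have h0 : 0 ≤ α := by linarith
  obtain ⟨r, hr, rfl⟩ : ∃ r : ℝ, 0 ≤ r ∧ t = ENNReal.ofReal r :=
    ⟨t.toReal, ENNReal.toReal_nonneg, (ENNReal.ofReal_toReal ht).symm⟩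
  rw [one_sub_add_sub_one_ofReal hr, ENNReal.ofReal_rpow_of_nonneg (abs_nonneg _) h0,
    ENNReal.ofReal_rpow_of_nonneg hr h0, ← ENNReal.ofReal_one, ← ENNReal.ofReal_mul h0,
    ← ENNReal.ofReal_add zero_le_one (by positivity),
    ← ENNReal.ofReal_add (by positivity) (by positivity),
    ← ENNReal.ofReal_add (by positivity) h0]
  refine ENNReal.ofReal_le_ofReal ?_
  linarith [abs_sub_one_rpow_le_bernoulli_gap hα hr]

theorem ennreal_min_sq_rpow_le_bernoulli_gap {α : ℝ} (h1 : 1 < α) (h2 : α ≤ 2) {t : ℝ≥0∞}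
    (ht : t ≠ ∞) :
    ENNReal.ofReal ((α - 1) / 4) *
      min (((1 - t) + (t - 1)) ^ (2 : ℝ)) (((1 - t) + (t - 1)) ^ α) +
      (1 + ENNReal.ofReal α * t) ≤ t ^ α + ENNReal.ofReal α := by
  have h0 : 0 ≤ α := by linarith
  have he : 0 ≤ (α - 1) / 4 := by linarith
  obtain ⟨r, hr, rfl⟩ : ∃ r : ℝ, 0 ≤ r ∧ t = ENNReal.ofReal r :=
    ⟨t.toReal, ENNReal.toReal_nonneg, (ENNReal.ofReal_toReal ht).symm⟩
  rw [one_sub_add_sub_one_ofReal hr, ENNReal.ofReal_rpow_of_nonneg (abs_nonneg _) h0,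
    ENNReal.ofReal_rpow_of_nonneg (abs_nonneg _) zero_le_two, ← ENNReal.ofReal_min,
    ENNReal.ofReal_rpow_of_nonneg hr h0, ← ENNReal.ofReal_one, ← ENNReal.ofReal_mul h0,
    ← ENNReal.ofReal_mul he, ← ENNReal.ofReal_add zero_le_one (by positivity),
    ← ENNReal.ofReal_add (by positivity) (by positivity),
    ← ENNReal.ofReal_add (by positivity) h0]
  refine ENNReal.ofReal_le_ofReal ?_
  linarith [min_sq_rpow_le_bernoulli_gap h1 h2 hr]

variable {μ : Measure E} [IsProbabilityMeasure μ] {f : E → ℝ≥0∞}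

/-- Integrated Bernoulli gap. -/
theorem lintegral_le_lintegral_rpow_sub_one (hf : Measurable f) (hf1 : ∫⁻ x, f x ∂μ = 1)
    {α : ℝ} {g : E → ℝ≥0∞}
    (hg : ∀ᵐ x ∂μ, g x + (1 + ENNReal.ofReal α * f x) ≤ f x ^ α + ENNReal.ofReal α) :
    ∫⁻ x, g x ∂μ ≤ ∫⁻ x, f x ^ α ∂μ - 1 := by
  have h := lintegral_mono_ae hg
  rw [lintegral_add_right _ (by fun_prop), lintegral_add_right _ measurable_const,
    lintegral_add_left measurable_const, lintegral_const_mul _ hf, hf1] at h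
  simp only [lintegral_const, measure_univ, mul_one] at h
  rw [← add_assoc, ENNReal.add_le_add_iff_right ENNReal.ofReal_ne_top] at h
  exact ENNReal.le_sub_of_add_le_right ENNReal.one_ne_top h

/-- Jensen for a concave power, read off from the monotonicity of `L^q` norms on a probability
space. -/
theorem lintegral_rpow_le_rpow_lintegral {q : ℝ} (hq : 0 < q) (hq1 : q ≤ 1) (hf : Measurable f) :
    ∫⁻ x, f x ^ q ∂μ ≤ (∫⁻ x, f x ∂μ) ^ q := by
  have h := eLpNorm'_le_eLpNorm'_of_exponent_le hq hq1 μ hf.aestronglyMeasurable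
  simp only [eLpNorm', enorm_eq_self, ENNReal.rpow_one, div_one] at h
  rwa [one_div, ENNReal.rpow_inv_le_iff hq] at h

theorem ofReal_mul_div_cancel {c : ℝ} (hc : 0 < c) (a : ℝ≥0∞) :
    ENNReal.ofReal c * (a / ENNReal.ofReal c) = a :=
  ENNReal.mul_div_cancel (ENNReal.ofReal_pos.2 hc).ne' ENNReal.ofReal_ne_top

theorem lintegral_abs_sub_one_rpow_le_of_two_le (hf : Measurable f) (hf1 : ∫⁻ x, f x ∂μ = 1)
    {α : ℝ} (hα : 2 ≤ α) :
    ∫⁻ x, ((1 - f x) + (f x - 1)) ^ α ∂μ ≤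
      ENNReal.ofReal (α - 1) * ((∫⁻ x, f x ^ α ∂μ - 1) / ENNReal.ofReal (α - 1)) := by
  rw [ofReal_mul_div_cancel (by linarith)]
  refine lintegral_le_lintegral_rpow_sub_one hf hf1 ?_
  filter_upwards [ae_lt_top hf (by simp [hf1])] with x hx
  exact ennreal_abs_sub_one_rpow_le_bernoulli_gap hα hx.ne

/-- For `d ≤ 1` the minimum is `d^2`, and `d^α = (d^2)^(α/2)`; for `d ≥ 1` the minimum is `d^α`
itself. -/
theorem rpow_le_min_add_min_rpow {α : ℝ} (h2 : α ≤ 2) (d : ℝ≥0∞) :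
    d ^ α ≤ min (d ^ (2 : ℝ)) (d ^ α) + min (d ^ (2 : ℝ)) (d ^ α) ^ (α / 2) := by
  rcases le_total d 1 with hd | hd
  · refine le_add_left ?_
    rw [min_eq_left (ENNReal.rpow_le_rpow_of_exponent_ge hd h2), ← ENNReal.rpow_mul,
      mul_div_cancel₀ _ two_ne_zero]
  · rw [min_eq_right (ENNReal.rpow_le_rpow_of_exponent_le hd h2)]
    exact le_self_add

/-- The truncated power `ψ` has integral at most `4 T`, and Jensen bounds that of `ψ^(α/2)` by `(4
T)^(α/2) ≤ 4 T^(α/2)`; hence `8 = 4 + 4`. -/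
theorem lintegral_abs_sub_one_rpow_le_of_le_two (hf : Measurable f) (hf1 : ∫⁻ x, f x ∂μ = 1)
    {α : ℝ} (h1 : 1 < α) (h2 : α ≤ 2) {T : ℝ≥0∞}
    (hT : T = (∫⁻ x, f x ^ α ∂μ - 1) / ENNReal.ofReal (α - 1)) :
    ∫⁻ x, ((1 - f x) + (f x - 1)) ^ α ∂μ ≤ 8 * max (T ^ (α / 2)) T := by
  have hd : Measurable fun x => (1 - f x) + (f x - 1) := by fun_prop
  set ψ : E → ℝ≥0∞ := fun x =>
    min (((1 - f x) + (f x - 1)) ^ (2 : ℝ)) (((1 - f x) + (f x - 1)) ^ α) with hψdef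
  have hψ : Measurable ψ := (hd.pow_const _).min (hd.pow_const _)
  have hψT : ∫⁻ x, ψ x ∂μ ≤ 4 * T := by
    have h : ∫⁻ x, ENNReal.ofReal ((α - 1) / 4) * ψ x ∂μ ≤ ∫⁻ x, f x ^ α ∂μ - 1 := by
      refine lintegral_le_lintegral_rpow_sub_one hf hf1 ?_
      filter_upwards [ae_lt_top hf (by simp [hf1])] with x hx
      exact ennreal_min_sq_rpow_le_bernoulli_gap h1 h2 hx.ne
    rw [lintegral_const_mul _ hψ] at h
    have h4 : (4 : ℝ≥0∞) * ENNReal.ofReal ((α - 1) / 4) = ENNReal.ofReal (α - 1) := by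
      rw [show (4 : ℝ≥0∞) = ENNReal.ofReal 4 by simp, ← ENNReal.ofReal_mul (by norm_num)]
      congr 1
      ring
    rw [hT, ← mul_div_assoc, ENNReal.le_div_iff_mul_le
      (Or.inl (ENNReal.ofReal_pos.2 (by linarith)).ne') (Or.inl ENNReal.ofReal_ne_top), ← h4]
    calc (∫⁻ x, ψ x ∂μ) * (4 * ENNReal.ofReal ((α - 1) / 4))
        = 4 * (ENNReal.ofReal ((α - 1) / 4) * ∫⁻ x, ψ x ∂μ) := by ring
      _ ≤ _ := by gcongr
  calc ∫⁻ x, ((1 - f x) + (f x - 1)) ^ α ∂μ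
      ≤ ∫⁻ x, (ψ x + ψ x ^ (α / 2)) ∂μ :=
        lintegral_mono fun x => rpow_le_min_add_min_rpow h2 _
    _ = ∫⁻ x, ψ x ∂μ + ∫⁻ x, ψ x ^ (α / 2) ∂μ := lintegral_add_left hψ _
    _ ≤ 4 * T + (4 * T) ^ (α / 2) := by
        refine add_le_add hψT ((lintegral_rpow_le_rpow_lintegral (by linarith) (by linarith)
          hψ).trans (ENNReal.rpow_le_rpow hψT (by linarith)))
    _ ≤ 4 * max (T ^ (α / 2)) T + 4 * max (T ^ (α / 2)) T := by
        rw [ENNReal.mul_rpow_of_nonneg _ _ (by linarith)]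
        gcongr
        · exact le_max_right _ _
        · calc (4 : ℝ≥0∞) ^ (α / 2) ≤ 4 ^ (1 : ℝ) :=
              ENNReal.rpow_le_rpow_of_exponent_le (by norm_num) (by linarith)
            _ = 4 := ENNReal.rpow_one _
        · exact le_max_left _ _
    _ = 8 * max (T ^ (α / 2)) T := by rw [← add_mul]; norm_num

/-! ### The two ranges of `α` -/

theorem kantorovichDist_le_of_le_two {E : Type*} [MetricSpace E]
    [TopologicalSpace.SeparableSpace E] [MeasurableSpace E] [BorelSpace E]
    {μ ν : Measure E} [IsProbabilityMeasure μ] [IsProbabilityMeasure ν] (hac : ν ≪ μ)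
    (x₀ : E) {p α β : ℝ} (hp : 1 ≤ p) (h1 : 1 < α) (h2 : α ≤ 2) (hβ : β = α / (α - 1)) :
    kantorovichDist p μ ν ≤ 16 * moment (β * p) μ x₀ *
      max (tsallis α ν μ ^ (1 / (2 * p))) (tsallis α ν μ ^ (1 / (α * p))) := by
  have hp0 : 0 < p := by linarith
  have hα0 : 0 < α := by linarith
  have hf := Measure.measurable_rnDeriv ν μ
  have hf1 : ∫⁻ x, ν.rnDeriv μ x ∂μ = 1 := by
    rw [Measure.lintegral_rnDeriv hac, measure_univ]
  have hW := kantorovichDist_withDensity_le hf hf1 x₀ hp h1 hβ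
  rw [Measure.withDensity_rnDeriv_eq _ _ hac] at hW
  have hD := lintegral_abs_sub_one_rpow_le_of_le_two hf hf1 h1 h2
    (T := tsallis α ν μ) (if_pos hac)
  set T := tsallis α ν μ
  have hq : 0 ≤ 1 / (α * p) := by positivity
  have key := ENNReal.rpow_le_rpow hD hq
  rw [ENNReal.mul_rpow_of_nonneg _ _ hq, (ENNReal.monotone_rpow_of_nonneg hq).map_max,
    ← ENNReal.rpow_mul, show α / 2 * (1 / (α * p)) = 1 / (2 * p) by field_simp] at key
  have h8 : (8 : ℝ≥0∞) ^ (1 / (α * p)) ≤ 8 := by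
    calc (8 : ℝ≥0∞) ^ (1 / (α * p)) ≤ 8 ^ (1 : ℝ) := by
          refine ENNReal.rpow_le_rpow_of_exponent_le (by norm_num) ?_
          rw [div_le_one (by positivity)]
          nlinarith
      _ = 8 := ENNReal.rpow_one _
  calc kantorovichDist p μ ν
      ≤ 2 * moment (β * p) μ x₀ * (8 * max (T ^ (1 / (2 * p))) (T ^ (1 / (α * p)))) :=
        hW.trans (by gcongr; exact key.trans (by gcongr))
    _ = (2 * 8) * moment (β * p) μ x₀ * max (T ^ (1 / (2 * p))) (T ^ (1 / (α * p))) := by ring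
    _ = _ := by norm_num

theorem kantorovichDist_le_of_two_le {E : Type*} [MetricSpace E]
    [TopologicalSpace.SeparableSpace E] [MeasurableSpace E] [BorelSpace E]
    {μ ν : Measure E} [IsProbabilityMeasure μ] [IsProbabilityMeasure ν] (hac : ν ≪ μ)
    (x₀ : E) {p α β : ℝ} (hp : 1 ≤ p) (hα : 2 ≤ α) (hβ : β = α / (α - 1)) :
    kantorovichDist p μ ν ≤ 2 * 3 ^ (α / p) * moment (β * p) μ x₀ *
      tsallis α ν μ ^ (1 / (α * p)) := by
  have hp0 : 0 < p := by linarith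
  have hα0 : 0 < α := by linarith
  have hf := Measure.measurable_rnDeriv ν μ
  have hf1 : ∫⁻ x, ν.rnDeriv μ x ∂μ = 1 := by
    rw [Measure.lintegral_rnDeriv hac, measure_univ]
  have hW := kantorovichDist_withDensity_le hf hf1 x₀ hp (by linarith) hβ
  rw [Measure.withDensity_rnDeriv_eq _ _ hac] at hW
  have hD := lintegral_abs_sub_one_rpow_le_of_two_le hf hf1 hα
  have hTdef : tsallis α ν μ =
    (∫⁻ x, ν.rnDeriv μ x ^ α ∂μ - 1) / ENNReal.ofReal (α - 1) := if_pos hac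
  rw [← hTdef] at hD
  set T := tsallis α ν μ
  have hq : 0 ≤ 1 / (α * p) := by positivity
  have key := ENNReal.rpow_le_rpow hD hq
  rw [ENNReal.mul_rpow_of_nonneg _ _ hq] at key
  -- The leftover factor `α - 1` is absorbed very generously: Bernoulli gives `α - 1 ≤ 1 + 2 α² ≤
  -- 3^(α²)`, and the power `1/(αp)` of this bound is `3^(α/p)`.
  have h3 : ENNReal.ofReal (α - 1) ^ (1 / (α * p)) ≤ 3 ^ (α / p) := by
    have hreal : α - 1 ≤ (3 : ℝ) ^ (α * α) := by
      have hb := one_add_mul_self_le_rpow_one_add (s := 2) (by norm_num) (p := α * α) (by nlinarith)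
      norm_num at hb
      nlinarith
    calc ENNReal.ofReal (α - 1) ^ (1 / (α * p))
        ≤ ((3 : ℝ≥0∞) ^ (α * α)) ^ (1 / (α * p)) := by
          refine ENNReal.rpow_le_rpow ((ENNReal.ofReal_le_ofReal hreal).trans_eq ?_) hq
          rw [← ENNReal.ofReal_rpow_of_nonneg (by norm_num) (by positivity)]
          simp
      _ = 3 ^ (α / p) := by
          rw [← ENNReal.rpow_mul]
          congr 1
          field_simp
  calc kantorovichDist p μ ν
      ≤ 2 * moment (β * p) μ x₀ * (3 ^ (α / p) * T ^ (1 / (α * p))) :=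
        hW.trans (by gcongr; exact key.trans (by gcongr))
    _ = _ := by ring

end TransportEntropy

theorem corollary3p1 :
    -- the case `1 < α ≤ 2`, with an absolute constant `C`
    (∃ C : ℝ≥0, ∀ (E : Type*) [MetricSpace E] [TopologicalSpace.SeparableSpace E]
      [MeasurableSpace E] [BorelSpace E] (μ ν : Measure E) [IsProbabilityMeasure μ]
      [IsProbabilityMeasure ν] (x₀ : E) (p α β : ℝ), 1 ≤ p → 1 < α → α ≤ 2 →
      β = α / (α - 1) →
      -- only the indeterminate product `0 · ∞` is excluded
      ¬ (TransportEntropy.moment (β * p) μ x₀ = 0 ∧ TransportEntropy.tsallis α ν μ = ∞) →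
      TransportEntropy.kantorovichDist p μ ν ≤
        C * TransportEntropy.moment (β * p) μ x₀ *
          max (TransportEntropy.tsallis α ν μ ^ (1 / (2 * p)))
            (TransportEntropy.tsallis α ν μ ^ (1 / (α * p)))) ∧
    -- the case `α ≥ 2`
    (∀ (E : Type*) [MetricSpace E] [TopologicalSpace.SeparableSpace E]
      [MeasurableSpace E] [BorelSpace E] (μ ν : Measure E) [IsProbabilityMeasure μ]
      [IsProbabilityMeasure ν] (x₀ : E) (p α β : ℝ), 1 ≤ p → 2 ≤ α →
      β = α / (α - 1) →
      ¬ (TransportEntropy.moment (β * p) μ x₀ = 0 ∧ TransportEntropy.tsallis α ν μ = ∞) →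
      TransportEntropy.kantorovichDist p μ ν ≤
        2 * 3 ^ (α / p) * TransportEntropy.moment (β * p) μ x₀ *
          TransportEntropy.tsallis α ν μ ^ (1 / (α * p))) := by
  refine ⟨⟨16, ?_⟩, ?_⟩
  · intro E _ _ _ _ μ ν _ _ x₀ p α β hp h1 h2 hβ hM
    by_cases hac : ν ≪ μ
    · exact TransportEntropy.kantorovichDist_le_of_le_two hac x₀ hp h1 h2 hβ
    -- In `ℝ≥0∞` one has `0 * ∞ = 0`, so the right side is `∞` only because `hM` forces a nonzero
    -- moment.
    · have hT : TransportEntropy.tsallis α ν μ = ∞ := if_neg hac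
      have hM0 : TransportEntropy.moment (β * p) μ x₀ ≠ 0 := fun h => hM ⟨h, hT⟩
      have hp0 : 0 < p := by linarith
      rw [hT, ENNReal.top_rpow_of_pos (y := 1 / (2 * p)) (by positivity), max_eq_left le_top,
        ENNReal.mul_top (mul_ne_zero (by norm_num) hM0)]
      exact le_top
  · intro E _ _ _ _ μ ν _ _ x₀ p α β hp hα hβ hM
    by_cases hac : ν ≪ μ
    · exact TransportEntropy.kantorovichDist_le_of_two_le hac x₀ hp hα hβ
    · have hT : TransportEntropy.tsallis α ν μ = ∞ := if_neg hac
      have hM0 : TransportEntropy.moment (β * p) μ x₀ ≠ 0 := fun h => hM ⟨h, hT⟩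
      have hq : 0 < 1 / (α * p) := by
        have : 0 < α * p := by nlinarith
        positivity
      have h3 : (3 : ℝ≥0∞) ^ (α / p) ≠ 0 :=
        (ENNReal.rpow_pos (by norm_num) (by norm_num)).ne'
      rw [hT, ENNReal.top_rpow_of_pos hq,
        ENNReal.mul_top (mul_ne_zero (mul_ne_zero two_ne_zero h3) hM0)]
      exact le_top
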